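/- **Setting.** Let $I\subset\mathbb R$ (times) and $D\subset\mathbb R^3$ (labels) be open and let $\mathbf x=\mathbf X(\mathbf x_0,t)$ be a $C^2$ Lagrangian map on $I\times D$, injective on $D$ for each $t\in I$, with $x_{ij}=\partial x^i/\partial x_0^j$ and $J=\det(x_{ij})>0$. Let $\rho_0>0$, $S_0$, $\mathbf B_0$ be $C^1$ on $D$, let $\varepsilon(\rho,S)$ (internal energy per unit volume) be $C^1$ for $\rho>0$, $S\in\mathbb R$, let $\Phi(\mathbf x)$ be an external potential and $\mu_0>0$. The fluid fields are, at $\mathbf x=\mathbf X(\mathbf x_0,t)$, $$\mathbf u=\frac{\partial \mathbf X}{\partial t},\quad \rho=\frac{\rho_0}{J},\quad S=S_0(\mathbf x_0),\quad B^i=\frac{x_{ij}B_0^j}{J},\quad h=\varepsilon_\rho,\quad \rho T=\varepsilon_S,\quad p=\rho\varepsilon_\rho-\varepsilon,\quad \frac{d}{dt}=\frac{\partial}{\partial t}+\mathbf u\cdot\nabla .$$ The MHD action is $\iint \mathcal L^0\,d^3x_0\,dt$ with $$\mathcal L^0=\tfrac12\rho_0|\mathbf x_t|^2-J\,\varepsilon\!\left(\frac{\rho_0}{J},S_0\right)-\frac{x_{ij}x_{is}B_0^jB_0^s}{2\mu_0J}-\rho_0\Phi(\mathbf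 x).$$ An infinitesimal transformation with generators $V^t,V^{\mathbf x_0},V^{\mathbf x}$ is a divergence symmetry with gauge four-vector $\Lambda_0^\alpha$ ($\alpha=0,1,2,3$) if $$\tilde X\mathcal L^0+\mathcal L^0\,(D_tV^t+D_{x_0^j}V^{x_0^j})+D_\alpha\Lambda_0^\alpha=0,\qquad(1)$$ where $D_0=D_t$, $D_j=D_{x_0^j}$, and where the extended operator $\tilde X$ has components $V^{\mathbf x_0},V^t,V^{\mathbf x}$ and $V^{x^k_\alpha}=D_\alpha\hat V^{x^k}+V^\beta D_\beta D_\alpha x^k$ along $\mathbf x_0,t,\mathbf x$ and $x^k_\alpha$, with $V^\beta=(V^t,V^{\mathbf x_0})$ and $\hat V^{\mathbf x}=V^{\mathbf x}-V^\beta D_\beta\mathbf x$. A fluid relabelling has $V^t=0$, $V^{\mathbf x}=0$, so $\hat V^{\mathbf x}=-V^{\mathbf x_0}\cdot\nabla_0\mathbf x$. Write $x^\alpha=(t,\mathbf x)$, $x_0^\alpha=(t,\mathbf x_0)$, $x_{\alpha\beta}=\partial x^\alpha/\partial x_0^\beta$ and $B_{\alpha\beta}=\operatorname{cofac}(\partial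 x_0^\alpha/\partial x^\beta)$. **Proposition.** Let $V^{\mathbf x_0}$ and $\Lambda_0^\alpha$ be $C^1$ functions of $(\mathbf x_0,t)\in D\times I$. For the fluid relabelling generated by $V^{\mathbf x_0}$: (a) Condition (1) is equivalent, at each $(\mathbf x_0,t)$, to the Lagrangian condition $$\begin{aligned}&\nabla_0\cdot(\rho_0V^{\mathbf x_0})\left(\tfrac12|\mathbf u|^2-\Phi-\frac{\varepsilon+p}{\rho}\right)-J\varepsilon_S\,V^{\mathbf x_0}\cdot\nabla_0S_0-D_t(\rho_0V^{\mathbf x_0})\cdot\nabla_0\mathbf x\cdot\mathbf u\\&-\frac1{\mu_0J}(\nabla_0\mathbf x)\cdot(\nabla_0\mathbf x)^T:\bigl[(V^{\mathbf x_0}\cdot\nabla_0\mathbf B_0)\mathbf B_0+\mathbf B_0\mathbf B_0\,\nabla_0\cdot V^{\mathbf x_0}-(\mathbf B_0\cdot\nabla_0V^{\mathbf x_0})\mathbf B_0\bigr]=-\frac{\partial\Lambda_0^\alpha}{\partial x_0^\alpha}.\end{aligned}\qquad(2)$$ (b) Condition (2) at $(\mathbf x_0,t)$ is equivalent to the Eulerian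 condition $$\begin{aligned}&\nabla\cdot(\rho\hat V^{\mathbf x})\left(h+\Phi-\tfrac12|\mathbf u|^2\right)+\rho T\,\hat V^{\mathbf x}\cdot\nabla S+\rho\mathbf u\cdot\left(\frac{d\hat V^{\mathbf x}}{dt}-\hat V^{\mathbf x}\cdot\nabla\mathbf u\right)\\&+\frac{\mathbf B}{\mu_0}\cdot\left[-\nabla\times(\hat V^{\mathbf x}\times\mathbf B)+\hat V^{\mathbf x}\,\nabla\cdot\mathbf B\right]=-\nabla_\alpha\Lambda^\alpha,\qquad\nabla_\alpha\Lambda^\alpha=\frac{\partial\Lambda^0}{\partial t}+\frac{\partial\Lambda^i}{\partial x^i},\end{aligned}\qquad(3)$$ at $(\mathbf X(\mathbf x_0,t),t)$; more precisely, the left-hand side of (2) is $J$ times that of (3), and $\partial\Lambda_0^\alpha/\partial x_0^\alpha=J\,\nabla_\alpha\Lambda^\alpha$. In particular (1) holds on all of $D\times I$ if and only if (3) holds at all $(\mathbf x,t)$ occupied by the fluid. (c) Here the gauge four-vector transforms as $\Lambda^\alpha=\Lambda_0^\beta B_{\beta\alpha}$, and $B_{\beta\alpha}=x_{\alpha\beta}/J$,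 so that $$\Lambda^\alpha=\Lambda_0^\beta\,\frac{x_{\alpha\beta}}{J},\qquad \Lambda^0=\frac{\Lambda_0^0}{J},\qquad \Lambda^j=\frac{u^j\Lambda_0^0+x_{js}\Lambda_0^s}{J}\quad(j=1,2,3).$$ -/

import Mathlib

open scoped Matrix

noncomputable section

namespace MHD

/-- Vectors with three Cartesian components. -/
abbrev V3 := Fin 3 → ℝ

/-- A time together with a point: `(t, x₀)` (labels) or `(t, x)` (positions). -/
abbrev TimeSpace := ℝ × V3

/-- The four coordinates `(t, x¹, x², x³)`, indexed by `0, 1, 2, 3`. -/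
def coord (q : TimeSpace) : Fin 4 → ℝ := Matrix.vecCons q.1 q.2

/-- The coordinate directions of `TimeSpace`: index `0` is time, index `i + 1` the `i`-th
space direction. -/
def basis4 : Fin 4 → TimeSpace := Matrix.vecCons (1, 0) (fun i => (0, Pi.single i 1))

/-- The partial derivative `∂_α f`; `α = 0` is the derivative in time. -/
def pd (α : Fin 4) (f : TimeSpace → ℝ) (q : TimeSpace) : ℝ := fderiv ℝ f q (basis4 α)

/-- Time derivative of a vector field, at fixed space variable. -/
def dt (F : TimeSpace → V3) (q : TimeSpace) : V3 := fun k => pd 0 (fun r => F r k) q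

/-- Spatial gradient. -/
def grad (f : TimeSpace → ℝ) (q : TimeSpace) : V3 := fun i => pd i.succ f q

/-- Spatial divergence. -/
def div (F : TimeSpace → V3) (q : TimeSpace) : ℝ := ∑ i, pd i.succ (fun r => F r i) q

/-- Spatial curl. -/
def curl (F : TimeSpace → V3) (q : TimeSpace) : V3 :=
  ![pd 2 (fun r => F r 2) q - pd 3 (fun r => F r 1) q,
    pd 3 (fun r => F r 0) q - pd 1 (fun r => F r 2) q,
    pd 1 (fun r => F r 1) q - pd 2 (fun r => F r 0) q]

/-- The directional derivative `(a · ∇) F`, with components `∑ i, a i * ∂_i F^k`. -/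
def advect (a : V3) (F : TimeSpace → V3) (q : TimeSpace) : V3 :=
  fun k => ∑ i, a i * pd i.succ (fun r => F r k) q

/-- The four-divergence `∂_α Λ^α`. -/
def div4 (Λ : TimeSpace → Fin 4 → ℝ) (q : TimeSpace) : ℝ := ∑ α, pd α (fun r => Λ r α) q

/-- The cofactor matrix of a square matrix (the transpose of the adjugate). -/
def cofac (A : Matrix (Fin 4) (Fin 4) ℝ) : Matrix (Fin 4) (Fin 4) ℝ := A.adjugateᵀ

/-- An ideal MHD flow in Lagrangian form: a Lagrangian map `x = X (t, x₀)` on an open set of times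
and an open set of labels, the label fields `ρ₀`, `S₀`, `B₀` (density, entropy, magnetic field),
the internal energy per unit volume `ε (ρ, S)`, the potential `Φ (x)` and the permeability `μ₀`.
Neither `∇₀ · B₀ = 0` nor the equation of motion is required. -/
structure Flow where
  times : Set ℝ
  labels : Set V3
  X : TimeSpace → V3
  ρ₀ : V3 → ℝ
  S₀ : V3 → ℝ
  B₀ : V3 → V3
  ε : ℝ × ℝ → ℝ
  Φ : V3 → ℝ
  μ₀ : ℝ
  isOpen_times : IsOpen times
  isOpen_labels : IsOpen labels
  contDiffOn_X : ContDiffOn ℝ 2 X (times ×ˢ labels)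
  injOn_X : ∀ t ∈ times, Set.InjOn (fun a => X (t, a)) labels
  jacobian_pos : ∀ q ∈ times ×ˢ labels,
    0 < (Matrix.of fun i j : Fin 3 => pd j.succ (fun r => X r i) q).det
  contDiffOn_ρ₀ : ContDiffOn ℝ 1 ρ₀ labels
  ρ₀_pos : ∀ a ∈ labels, 0 < ρ₀ a
  contDiffOn_S₀ : ContDiffOn ℝ 1 S₀ labels
  contDiffOn_B₀ : ContDiffOn ℝ 1 B₀ labels
  contDiffOn_ε : ContDiffOn ℝ 1 ε (Set.Ioi 0 ×ˢ Set.univ)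
  μ₀_pos : 0 < μ₀

namespace Flow

variable (M : Flow)

/-- The set of all `(t, x₀)` on which the Lagrangian description lives. -/
def labelDomain : Set TimeSpace := M.times ×ˢ M.labels

/-- The map `(t, x₀) ↦ (t, x)`. -/
def lagMap (q : TimeSpace) : TimeSpace := (q.1, M.X q)

/-- The set of all `(t, x)` occupied by the fluid. -/
def region : Set TimeSpace := M.lagMap '' M.labelDomain

/-- The inverse map `(t, x) ↦ (t, x₀)`. -/
def invMap : TimeSpace → TimeSpace := Function.invFunOn M.lagMap M.labelDomain

/-- The deformation matrix `x_{ij} = ∂x^i/∂x₀^j`. -/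
def defMat (q : TimeSpace) : Matrix (Fin 3) (Fin 3) ℝ :=
  Matrix.of fun i j => pd j.succ (fun r => M.X r i) q

/-- `J = det (x_{ij})`. -/
def jac (q : TimeSpace) : ℝ := (M.defMat q).det

/-- The `4 × 4` matrix `x_{αβ} = ∂x^α/∂x₀^β`. -/
def defMat4 (q : TimeSpace) : Matrix (Fin 4) (Fin 4) ℝ :=
  Matrix.of fun α β => pd β (fun r => coord (M.lagMap r) α) q

/-- The `4 × 4` matrix `∂x₀^α/∂x^β`. -/
def invDefMat4 (p : TimeSpace) : Matrix (Fin 4) (Fin 4) ℝ :=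
  Matrix.of fun α β => pd β (fun r => coord (M.invMap r) α) p

/-! ### Thermodynamics -/

/-- `∂ε/∂S`. -/
def energyS (ρ S : ℝ) : ℝ := deriv (fun s => M.ε (ρ, s)) S

/-- The enthalpy `h = ∂ε/∂ρ`. -/
def enthalpy (ρ S : ℝ) : ℝ := deriv (fun r => M.ε (r, S)) ρ

/-- The temperature, `ρ T = ∂ε/∂S`. -/
def temperature (ρ S : ℝ) : ℝ := M.energyS ρ S / ρ

/-- The gas pressure `p = ρ ∂ε/∂ρ - ε`. -/
def pressure (ρ S : ℝ) : ℝ := ρ * M.enthalpy ρ S - M.ε (ρ, S)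

/-! ### Eulerian fields, as functions of `(t, x)` -/

/-- Fluid velocity `u = ∂x/∂t` at fixed label. -/
def u (p : TimeSpace) : V3 := dt M.X (M.invMap p)

/-- `ρ = ρ₀ / J`. -/
def ρ (p : TimeSpace) : ℝ := M.ρ₀ (M.invMap p).2 / M.jac (M.invMap p)

/-- `S = S₀ (x₀)`. -/
def S (p : TimeSpace) : ℝ := M.S₀ (M.invMap p).2

/-- `B^i = x_{ij} B₀^j / J`. -/
def B (p : TimeSpace) : V3 :=
  (M.jac (M.invMap p))⁻¹ • (M.defMat (M.invMap p) *ᵥ M.B₀ (M.invMap p).2)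

/-- `h (ρ, S)` as a field. -/
def h (p : TimeSpace) : ℝ := M.enthalpy (M.ρ p) (M.S p)

/-- `T (ρ, S)` as a field. -/
def T (p : TimeSpace) : ℝ := M.temperature (M.ρ p) (M.S p)

/-- The derivative following the flow, `d/dt = ∂/∂t + u · ∇`. -/
def materialDeriv (F : TimeSpace → V3) (p : TimeSpace) : V3 := dt F p + advect (M.u p) F p

/-! ### The action and its divergence symmetries -/

end Flow

/-- Jet space with coordinates `(x₀, t, x, x_t, x_{ij})`. -/
abbrev Jet := V3 × ℝ × V3 × V3 × Matrix (Fin 3) (Fin 3) ℝ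

/-- An infinitesimal transformation `t' = t + ϵ Vt`, `x₀' = x₀ + ϵ Vx₀`, `x' = x + ϵ Vx`; the
generators are recorded as functions of `(t, x₀)` along the flow. -/
structure Generator where
  Vt : TimeSpace → ℝ
  Vx₀ : TimeSpace → V3
  Vx : TimeSpace → V3

/-- The generator of a fluid relabelling: `V^t = 0`, `V^x = 0`. -/
def relabelling (ξ : TimeSpace → V3) : Generator := ⟨fun _ => 0, ξ, fun _ => 0⟩

/-- The four-vector `V^α = (V^t, V^{x₀})`. -/
def Generator.V4 (g : Generator) (q : TimeSpace) : Fin 4 → ℝ := Matrix.vecCons (g.Vt q) (g.Vx₀ q)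

namespace Flow

variable (M : Flow)

/-- The Lagrangian density
`L⁰ = ρ₀ |x_t|² / 2 - J ε (ρ₀ / J, S₀) - x_{ij} x_{is} B₀^j B₀^s / (2 μ₀ J) - ρ₀ Φ (x)`,
as a function on jet space. The action is the integral of `L⁰` over labels and time. -/
def L₀ : Jet → ℝ := fun (x₀, _, x, v, F) =>
  M.ρ₀ x₀ * (v ⬝ᵥ v) / 2 - F.det * M.ε (M.ρ₀ x₀ / F.det, M.S₀ x₀)
    - ((F *ᵥ M.B₀ x₀) ⬝ᵥ (F *ᵥ M.B₀ x₀)) / (2 * M.μ₀ * F.det) - M.ρ₀ x₀ * M.Φ x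

/-- The jet of the Lagrangian map at `(t, x₀)`. -/
def jet (q : TimeSpace) : Jet := (q.2, q.1, M.X q, dt M.X q, M.defMat q)

/-- The canonical (evolutionary) generator, as a function of `(t, x₀)`:
`V̂^k = V^{x^k} - (V^t ∂/∂t + V^{x₀^s} ∂/∂x₀^s) x^k`. -/
def canonical (g : Generator) (q : TimeSpace) : V3 :=
  fun k => g.Vx q k - ∑ α, g.V4 q α * pd α (fun r => M.X r k) q

/-- The coefficient `D_α V̂^k + V^β D_β D_α x^k` of `∂/∂x^k_α` in the extended operator. -/
def prolong (g : Generator) (α : Fin 4) (q : TimeSpace) : V3 :=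
  fun k => pd α (fun r => M.canonical g r k) q
    + ∑ β, g.V4 q β * pd β (fun r => pd α (fun r' => M.X r' k) r) q

/-- The extended vector field on jet space at the jet of the Lagrangian map at `(t, x₀)`. -/
def extended (g : Generator) (q : TimeSpace) : Jet :=
  (g.Vx₀ q, g.Vt q, g.Vx q, M.prolong g 0 q, Matrix.of fun k j => M.prolong g j.succ q k)

/-- The divergence symmetry condition at `(t, x₀)`:
`X̃ L⁰ + L⁰ (D_t V^t + D_{x₀^j} V^{x₀^j}) + D_α Λ₀^α = 0`, where `X̃` is the extended operator. -/
def DivSymmetryAt (g : Generator) (Λ₀ : TimeSpace → Fin 4 → ℝ) (q : TimeSpace) : Prop :=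
  lineDeriv ℝ M.L₀ (M.jet q) (M.extended g q) + M.L₀ (M.jet q) * div4 g.V4 q + div4 Λ₀ q = 0

/-! ### Lagrangian form of the condition for a relabelling -/

/-- The left-hand side of the Lagrangian condition,
`∇₀·(ρ₀ ξ) (|u|²/2 - Φ - (ε + p)/ρ) - J ε_S ξ·∇₀S - D_t(ρ₀ ξ)·∇₀x·u
  - (μ₀ J)⁻¹ (∇₀x)·(∇₀x)ᵀ : [(ξ·∇₀B₀) B₀ + B₀ B₀ ∇₀·ξ - (B₀·∇₀ξ) B₀]`. -/
def lagrangianLHS (ξ : TimeSpace → V3) (q : TimeSpace) : ℝ :=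
  let F := M.defMat q
  let J := M.jac q
  let ρ := M.ρ₀ q.2 / J
  let S := M.S₀ q.2
  let B₀ := M.B₀ q.2
  let v := dt M.X q
  div (fun r => M.ρ₀ r.2 • ξ r) q
      * ((v ⬝ᵥ v) / 2 - M.Φ (M.X q) - (M.ε (ρ, S) + M.pressure ρ S) / ρ)
    - J * M.energyS ρ S * (ξ q ⬝ᵥ grad (fun r => M.S₀ r.2) q)
    - (F *ᵥ dt (fun r => M.ρ₀ r.2 • ξ r) q) ⬝ᵥ v
    - 1 / (M.μ₀ * J) * ∑ j, ∑ s, (Fᵀ * F) j s *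
        (Matrix.vecMulVec (advect (ξ q) (fun r => M.B₀ r.2) q) B₀
          + div ξ q • Matrix.vecMulVec B₀ B₀
          - Matrix.vecMulVec (advect B₀ ξ q) B₀) j s

/-! ### Eulerian form of the condition for a relabelling -/

/-- The canonical generator of the relabelling as an Eulerian field. -/
def Vhat (ξ : TimeSpace → V3) (p : TimeSpace) : V3 := M.canonical (relabelling ξ) (M.invMap p)

/-- The Eulerian gauge four-vector `Λ^α = Λ₀^β B_{βα}`, `B_{βα} = cofac (∂x₀^β/∂x^α)`. -/
def gauge (Λ₀ : TimeSpace → Fin 4 → ℝ) (p : TimeSpace) : Fin 4 → ℝ :=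
  fun α => ∑ β, Λ₀ (M.invMap p) β * cofac (M.invDefMat4 p) β α

/-- The left-hand side of the Eulerian condition,
`∇·(ρV̂) (h + Φ - |u|²/2) + ρ T V̂·∇S + ρ u·(dV̂/dt - V̂·∇u)
  + (B/μ₀)·[-∇×(V̂×B) + V̂ ∇·B]`. -/
def eulerianLHS (ξ : TimeSpace → V3) (p : TimeSpace) : ℝ :=
  let V := M.Vhat ξ
  div (fun r => M.ρ r • V r) p * (M.h p + M.Φ p.2 - (M.u p ⬝ᵥ M.u p) / 2)
    + M.ρ p * M.T p * (V p ⬝ᵥ grad M.S p)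
    + M.ρ p * (M.u p ⬝ᵥ (M.materialDeriv V p - advect (V p) M.u p))
    + (M.μ₀⁻¹ • M.B p) ⬝ᵥ
        (-curl (fun r => crossProduct (V r) (M.B r)) p + div M.B p • V p)

end Flow

end MHD

end

/-! Everything is compared at labels. Write F for the deformation matrix, J for its determinant and
ξ for the label generator; the canonical generator is then V̂ = -Fξ, the pushforward of -ξ.

From Eulerian to Lagrangian form: each fluid field is a label-space function composed with the
inverse map. Its derivative along a pushed-forward direction Fb is the label derivative along b
(`sum_mulVec_pd_comp_invMap`), and its material derivative is the time derivative at fixed label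
(`material_pd_comp_invMap`). Divergences are governed by the space-time Piola identity
(`jac_mul_div4_push`): J times the divergence of a four-vector pushed forward and divided by J is
the divergence of the original. Jacobi's formula and symmetry of second derivatives give that
identity. It yields the gauge term and the mass flux term at once. The velocity bracket becomes -F
∂ξ/∂t, and the magnetic bracket, expanded by the product rule, becomes -F[ξ·∇₀B₀ + B₀∇₀·ξ -
B₀·∇₀ξ]/J. With (ε + p)/ρ = h the two left-hand sides differ exactly by the factor J > 0
(`lagrangianLHS_eq`).

From the symmetry condition to the Lagrangian form: for a relabelling the second derivatives of x
cancel in the prolongation, leaving variations -F ∂ξ/∂t of x_t and -F∇₀ξ of F, hence -J∇₀·ξ of J.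
Differentiating the density along this line and adding L⁰∇₀·ξ gives the Lagrangian left-hand side
identically (`lineDeriv_L₀`). -/

namespace MHD

open Filter Topology

/-! ### Derivatives of determinants -/

/-- Jacobi's formula for the derivative of a determinant. -/
theorem hasFDerivAt_matrix_det {E : Type*} [NormedAddCommGroup E] [NormedSpace ℝ E] {n : ℕ}
    {A : E → Matrix (Fin n) (Fin n) ℝ} {A' : Fin n → Fin n → E →L[ℝ] ℝ} {x : E}
    (hA : ∀ i j, HasFDerivAt (fun y => A y i j) (A' i j) x) :
    HasFDerivAt (fun y => (A y).det) (∑ i, ∑ j, (A x).adjugate j i • A' i j) x := by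
  let D : ContinuousMultilinearMap ℝ (fun _ : Fin n => Fin n → ℝ) ℝ :=
    ⟨(Matrix.detRowAlternating (R := ℝ) (n := Fin n)).toMultilinearMap,
      Continuous.matrix_det (A := fun M : Matrix (Fin n) (Fin n) ℝ => M) continuous_id⟩
  have hrow : HasFDerivAt (fun y => (fun i j => A y i j : Fin n → Fin n → ℝ))
      (ContinuousLinearMap.pi fun i => ContinuousLinearMap.pi fun j => A' i j) x :=
    hasFDerivAt_pi.2 fun i => hasFDerivAt_pi.2 fun j => hA i j
  have hD := (D.hasFDerivAt (fun i j => A x i j)).comp x hrow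
  refine hD.congr_fderiv ?_
  ext w
  simp only [ContinuousLinearMap.comp_apply, ContinuousMultilinearMap.linearDeriv_apply,
    sum_apply, smul_apply, smul_eq_mul]
  refine Finset.sum_congr rfl fun i _ => ?_
  -- The multilinear derivative replaces row i by its variation; Cramer's rule for the transpose
  -- expresses that determinant through the adjugate.
  have h := Matrix.cramer_transpose_apply (A x) (fun j => A' i j w) i
  rw [Matrix.cramer_eq_adjugate_mulVec, ← Matrix.adjugate_transpose] at h
  refine Eq.trans h.symm ?_
  simp [Matrix.mulVec, dotProduct, Matrix.transpose_apply]

theorem hasDerivAt_matrix_det {n : ℕ} {A : ℝ → Matrix (Fin n) (Fin n) ℝ}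
    {A' : Matrix (Fin n) (Fin n) ℝ} {t : ℝ}
    (hA : ∀ i j, HasDerivAt (fun s => A s i j) (A' i j) t) :
    HasDerivAt (fun s => (A s).det) ((A t).adjugate * A').trace t := by
  have h := (hasFDerivAt_matrix_det fun i j => (hA i j).hasFDerivAt).hasDerivAt
  refine h.congr_deriv ?_
  simp only [sum_apply, smul_apply, smul_eq_mul,
    Matrix.trace, Matrix.diag, Matrix.mul_apply]
  rw [Finset.sum_comm]
  simp

/-! ### Calculus of partial derivatives in time and space -/

theorem basis4_zero : basis4 0 = (1, 0) := rfl

theorem basis4_succ (i : Fin 3) : basis4 i.succ = (0, Pi.single i 1) := rfl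

theorem pd_congr {f g : TimeSpace → ℝ} {q : TimeSpace} (h : f =ᶠ[𝓝 q] g) (α : Fin 4) :
    pd α f q = pd α g q := by
  rw [pd, pd, h.fderiv_eq]

section pd

variable {f g : TimeSpace → ℝ} {q : TimeSpace}

theorem pd_sub (hf : DifferentiableAt ℝ f q) (hg : DifferentiableAt ℝ g q) (α : Fin 4) :
    pd α (fun r => f r - g r) q = pd α f q - pd α g q := by
  simp [pd, fderiv_fun_sub hf hg]

theorem pd_neg (α : Fin 4) : pd α (fun r => -f r) q = -pd α f q := by
  simp [pd, fderiv_fun_neg]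

theorem pd_const (c : ℝ) (α : Fin 4) : pd α (fun _ => c) q = 0 := by
  simp [pd]

theorem pd_mul (hf : DifferentiableAt ℝ f q) (hg : DifferentiableAt ℝ g q) (α : Fin 4) :
    pd α (fun r => f r * g r) q = f q * pd α g q + pd α f q * g q := by
  simp [pd, fderiv_fun_mul hf hg, mul_comm]

theorem pd_sum {ι : Type*} {s : Finset ι} {f : ι → TimeSpace → ℝ}
    (hf : ∀ i ∈ s, DifferentiableAt ℝ (f i) q) (α : Fin 4) :
    pd α (fun r => ∑ i ∈ s, f i r) q = ∑ i ∈ s, pd α (f i) q := by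
  simp [pd, fderiv_fun_sum hf]

theorem pd_inv (hf : DifferentiableAt ℝ f q) (h0 : f q ≠ 0) (α : Fin 4) :
    pd α (fun r => (f r)⁻¹) q = -(pd α f q / f q ^ 2) := by
  have h := ((hasDerivAt_inv h0).comp_hasFDerivAt q hf.hasFDerivAt).fderiv
  rw [pd, pd]
  refine (congrArg (fun L => L (basis4 α)) h).trans ?_
  simp [div_eq_mul_inv, mul_comm]

/-- A derivative in direction `(τ, a)` in terms of partial derivatives. -/
theorem fderiv_apply_eq_pd (f : TimeSpace → ℝ) (q : TimeSpace) (τ : ℝ) (a : V3) :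
    fderiv ℝ f q (τ, a) = τ * pd 0 f q + ∑ i : Fin 3, a i * pd i.succ f q := by
  have h : ((τ, a) : TimeSpace) = τ • basis4 0 + ∑ i : Fin 3, a i • basis4 i.succ := by
    ext k
    · simp [basis4_zero, basis4_succ, Prod.fst_sum]
    · fin_cases k <;> simp [basis4_zero, basis4_succ, Fin.sum_univ_three]
  rw [h, map_add, map_sum]
  simp [pd]

theorem pd_det {n : ℕ} {A : TimeSpace → Matrix (Fin n) (Fin n) ℝ}
    (hA : ∀ i j, DifferentiableAt ℝ (fun r => A r i j) q) (α : Fin 4) :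
    pd α (fun r => (A r).det) q
      = ((A q).adjugate * Matrix.of fun i j => pd α (fun r => A r i j) q).trace := by
  rw [pd, (hasFDerivAt_matrix_det fun i j => (hA i j).hasFDerivAt).fderiv]
  simp only [sum_apply, smul_apply, smul_eq_mul,
    Matrix.trace, Matrix.diag, Matrix.mul_apply, Matrix.of_apply, pd]
  rw [Finset.sum_comm]

theorem differentiableAt_det {n : ℕ} {A : TimeSpace → Matrix (Fin n) (Fin n) ℝ}
    (hA : ∀ i j, DifferentiableAt ℝ (fun r => A r i j) q) :
    DifferentiableAt ℝ (fun r => (A r).det) q :=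
  (hasFDerivAt_matrix_det fun i j => (hA i j).hasFDerivAt).differentiableAt

/-- Symmetry of second partial derivatives. -/
theorem pd_comm (hf : ContDiffAt ℝ 2 f q) (α β : Fin 4) :
    pd α (fun r => pd β f r) q = pd β (fun r => pd α f r) q := by
  have hd : DifferentiableAt ℝ (fderiv ℝ f) q :=
    (hf.fderiv_right (m := 1) (by norm_num)).differentiableAt (by norm_num)
  have hs : IsSymmSndFDerivAt ℝ f q := hf.isSymmSndFDerivAt (by simp)
  have key : ∀ v : TimeSpace, fderiv ℝ (fun r => fderiv ℝ f r v) q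
      = (fderiv ℝ (fderiv ℝ f) q).flip v := by
    intro v
    have := hd.hasFDerivAt.clm_apply (hasFDerivAt_const v q)
    rw [this.fderiv]
    ext <;> simp
  simp only [pd, key, ContinuousLinearMap.flip_apply]
  exact hs _ _

theorem differentiableAt_pd (hf : ContDiffAt ℝ 2 f q) (α : Fin 4) :
    DifferentiableAt ℝ (fun r => pd α f r) q :=
  ((hf.fderiv_right (m := 1) (by norm_num)).differentiableAt (by norm_num)).clm_apply
    (differentiableAt_const _)

end pd

/-! ### The Lagrangian map, its inverse and the chain rule -/

namespace Flow

variable {M : Flow} {q : TimeSpace}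

theorem isOpen_labelDomain (M : Flow) : IsOpen M.labelDomain :=
  M.isOpen_times.prod M.isOpen_labels

theorem contDiffAt_X (hq : q ∈ M.labelDomain) : ContDiffAt ℝ 2 M.X q :=
  M.contDiffOn_X.contDiffAt (M.isOpen_labelDomain.mem_nhds hq)

theorem contDiffAt_X_apply (hq : q ∈ M.labelDomain) (k : Fin 3) :
    ContDiffAt ℝ 2 (fun r => M.X r k) q :=
  contDiffAt_pi.1 (contDiffAt_X hq) k

theorem contDiffAt_lagMap (hq : q ∈ M.labelDomain) : ContDiffAt ℝ 2 M.lagMap q :=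
  contDiffAt_fst.prodMk (contDiffAt_X hq)

theorem jac_pos (hq : q ∈ M.labelDomain) : 0 < M.jac q :=
  M.jacobian_pos q hq

theorem injOn_lagMap (M : Flow) : Set.InjOn M.lagMap M.labelDomain := by
  rintro ⟨t, a⟩ hq ⟨t', a'⟩ hq' h
  obtain ⟨h1, h2⟩ := Prod.ext_iff.1 h
  obtain rfl : t = t' := h1
  exact Prod.ext rfl (M.injOn_X t hq.1 hq.2 hq'.2 h2)

theorem fderiv_lagMap (hq : q ∈ M.labelDomain) (τ : ℝ) (a : V3) :
    fderiv ℝ M.lagMap q (τ, a) = (τ, τ • dt M.X q + M.defMat q *ᵥ a) := by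
  have hX : DifferentiableAt ℝ M.X q := (contDiffAt_X hq).differentiableAt (by norm_num)
  have h : HasFDerivAt M.lagMap ((ContinuousLinearMap.fst ℝ ℝ V3).prod (fderiv ℝ M.X q)) q :=
    hasFDerivAt_fst.prodMk hX.hasFDerivAt
  rw [h.fderiv]
  refine Prod.ext rfl (funext fun k => ?_)
  have hk : fderiv ℝ (fun r => M.X r k) q (τ, a) = fderiv ℝ M.X q (τ, a) k := by
    rw [(hasFDerivAt_pi'.1 hX.hasFDerivAt k).fderiv]
    rfl
  refine hk.symm.trans ?_
  rw [fderiv_apply_eq_pd]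
  simp [dt, defMat, Matrix.mulVec, dotProduct, mul_comm]

/-- The derivative is block triangular: its time component returns τ, and once τ = 0 only F acts,
which is invertible because J > 0. -/
theorem fderiv_lagMap_injective (hq : q ∈ M.labelDomain) :
    Function.Injective (fderiv ℝ M.lagMap q) := by
  rw [injective_iff_map_eq_zero]
  rintro ⟨τ, a⟩ h
  rw [fderiv_lagMap hq] at h
  obtain ⟨h1, h2⟩ := Prod.ext_iff.1 h
  obtain rfl : τ = 0 := h1
  have h3 : M.defMat q *ᵥ a = 0 := by simpa using h2
  exact Prod.ext rfl (Matrix.eq_zero_of_mulVec_eq_zero (jac_pos hq).ne' h3)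

theorem invMap_lagMap (hq : q ∈ M.labelDomain) : M.invMap (M.lagMap q) = q :=
  M.injOn_lagMap.leftInvOn_invFunOn hq

/-- The inverse function theorem for the Lagrangian map. -/
theorem hasFDerivAt_invMap (hq : q ∈ M.labelDomain) :
    ∃ N : TimeSpace →L[ℝ] TimeSpace, HasFDerivAt M.invMap N (M.lagMap q) ∧
      (∀ w, N (fderiv ℝ M.lagMap q w) = w) ∧
      ∀ᶠ p in 𝓝 (M.lagMap q), M.invMap p ∈ M.labelDomain ∧ M.lagMap (M.invMap p) = p := by
  -- In finite dimension an injective endomorphism is an isomorphism, as the inverse function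
  -- theorem requires.
  let e : TimeSpace ≃L[ℝ] TimeSpace :=
    (LinearEquiv.ofInjectiveEndo (fderiv ℝ M.lagMap q : TimeSpace →ₗ[ℝ] TimeSpace)
      (fderiv_lagMap_injective hq)).toContinuousLinearEquiv
  have he : ∀ w, e w = fderiv ℝ M.lagMap q w := fun w => rfl
  have hs : HasStrictFDerivAt M.lagMap (e : TimeSpace →L[ℝ] TimeSpace) q := by
    have h := (contDiffAt_lagMap hq).hasStrictFDerivAt (by norm_num)
    exact h.congr_fderiv (by ext w <;> rfl)
  have hg := hs.to_localInverse
  set g := hs.localInverse M.lagMap e q with hg_def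
  have hgq : g (M.lagMap q) = q := hs.localInverse_apply_image
  have hmem : ∀ᶠ p in 𝓝 (M.lagMap q), g p ∈ M.labelDomain :=
    hs.localInverse_continuousAt.eventually
      (by rw [← hg_def, hgq]; exact M.isOpen_labelDomain.mem_nhds hq)
  -- `invMap` is a chosen global inverse with no regularity of its own. Injectivity on the label
  -- domain forces it to agree with the local inverse near the point, so it inherits
  -- differentiability.
  have hev : ∀ᶠ p in 𝓝 (M.lagMap q), M.invMap p = g p ∧ g p ∈ M.labelDomain ∧
      M.lagMap (g p) = p := by
    filter_upwards [hmem, hs.eventually_right_inverse] with p h1 h2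
    refine ⟨?_, h1, h2⟩
    rw [← h2, invMap_lagMap h1, h2]
  refine ⟨_, hg.hasFDerivAt.congr_of_eventuallyEq (hev.mono fun p h => h.1), fun w => ?_, ?_⟩
  · rw [← he]
    exact e.symm_apply_apply w
  · filter_upwards [hev] with p h
    rw [h.1]
    exact h.2

theorem differentiableAt_comp_invMap (hq : q ∈ M.labelDomain) {f : TimeSpace → ℝ}
    (hf : DifferentiableAt ℝ f q) :
    DifferentiableAt ℝ (fun p => f (M.invMap p)) (M.lagMap q) := by
  obtain ⟨N, hN, -, -⟩ := hasFDerivAt_invMap hq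
  rw [← invMap_lagMap hq] at hf
  exact hf.comp _ hN.differentiableAt

/-- Testing only on pushed-forward directions avoids inverting the deformation matrix: the
derivative of the inverse map undoes that of `lagMap`. -/
theorem fderiv_comp_invMap (hq : q ∈ M.labelDomain) {f : TimeSpace → ℝ}
    (hf : DifferentiableAt ℝ f q) (w : TimeSpace) :
    fderiv ℝ (fun p => f (M.invMap p)) (M.lagMap q) (fderiv ℝ M.lagMap q w) = fderiv ℝ f q w := by
  obtain ⟨N, hN, hw, -⟩ := hasFDerivAt_invMap hq
  have hf' := hf.hasFDerivAt
  have h : HasFDerivAt (fun p => f (M.invMap p)) ((fderiv ℝ f q).comp N) (M.lagMap q) :=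
    HasFDerivAt.comp (M.lagMap q) (by rwa [invMap_lagMap hq]) hN
  rw [h.fderiv, ContinuousLinearMap.comp_apply, hw]

/-- The derivative in a direction pushed forward from the labels. -/
theorem sum_mulVec_pd_comp_invMap (hq : q ∈ M.labelDomain) {f : TimeSpace → ℝ}
    (hf : DifferentiableAt ℝ f q) (b : V3) :
    ∑ i : Fin 3, (M.defMat q *ᵥ b) i * pd i.succ (fun p => f (M.invMap p)) (M.lagMap q)
      = ∑ s : Fin 3, b s * pd s.succ f q := by
  have h := fderiv_comp_invMap hq hf (0, b)
  rw [fderiv_lagMap hq, fderiv_apply_eq_pd, fderiv_apply_eq_pd] at h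
  simpa using h

/-- The material derivative is the time derivative at fixed label. -/
theorem material_pd_comp_invMap (hq : q ∈ M.labelDomain) {f : TimeSpace → ℝ}
    (hf : DifferentiableAt ℝ f q) :
    pd 0 (fun p => f (M.invMap p)) (M.lagMap q)
        + ∑ i : Fin 3, dt M.X q i * pd i.succ (fun p => f (M.invMap p)) (M.lagMap q)
      = pd 0 f q := by
  have h := fderiv_comp_invMap hq hf (1, 0)
  rw [fderiv_lagMap hq, fderiv_apply_eq_pd, fderiv_apply_eq_pd] at h
  simpa using h

theorem differentiableAt_defMat (hq : q ∈ M.labelDomain) (i j : Fin 3) :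
    DifferentiableAt ℝ (fun r => M.defMat r i j) q :=
  differentiableAt_pd (contDiffAt_X_apply hq i) j.succ

theorem differentiableAt_jac (hq : q ∈ M.labelDomain) : DifferentiableAt ℝ M.jac q :=
  differentiableAt_det (differentiableAt_defMat hq)

/-! ### The space-time deformation matrix, its cofactors and the Piola identity -/

theorem contDiffAt_coord_lagMap (hq : q ∈ M.labelDomain) (α : Fin 4) :
    ContDiffAt ℝ 2 (fun r => coord (M.lagMap r) α) q := by
  refine Fin.cases ?_ (fun k => ?_) α
  · exact contDiffAt_fst
  · exact contDiffAt_X_apply hq k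

theorem differentiableAt_defMat4 (hq : q ∈ M.labelDomain) (α β : Fin 4) :
    DifferentiableAt ℝ (fun r => M.defMat4 r α β) q :=
  differentiableAt_pd (contDiffAt_coord_lagMap hq α) β

theorem defMat4_zero_zero (q : TimeSpace) : M.defMat4 q 0 0 = 1 := by
  change fderiv ℝ (Prod.fst : TimeSpace → ℝ) q (1, 0) = 1
  rw [fderiv_fst]; rfl

theorem defMat4_zero_succ (q : TimeSpace) (j : Fin 3) : M.defMat4 q 0 j.succ = 0 := by
  change fderiv ℝ (Prod.fst : TimeSpace → ℝ) q (0, Pi.single j 1) = 0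
  rw [fderiv_fst]; rfl

theorem defMat4_succ_zero (q : TimeSpace) (i : Fin 3) :
    M.defMat4 q i.succ 0 = dt M.X q i := rfl

theorem defMat4_succ_succ (q : TimeSpace) (i j : Fin 3) :
    M.defMat4 q i.succ j.succ = M.defMat q i j := rfl

/-- Time is preserved, so the first row is (1, 0, 0, 0), and expansion along it leaves the spatial
block. -/
theorem det_defMat4 (q : TimeSpace) : (M.defMat4 q).det = M.jac q := by
  rw [Matrix.det_succ_row_zero, Fin.sum_univ_succ]
  simp only [defMat4_zero_zero, defMat4_zero_succ]
  simp only [Fin.val_zero, pow_zero, mul_one, one_mul, mul_zero, zero_mul, Finset.sum_const_zero,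
    add_zero]
  rfl

theorem fderiv_lagMap_basis4 (hq : q ∈ M.labelDomain) (β α : Fin 4) :
    coord (fderiv ℝ M.lagMap q (basis4 β)) α = M.defMat4 q α β := by
  refine Fin.cases ?_ (fun j => ?_) β
  · rw [basis4_zero, fderiv_lagMap hq]
    refine Fin.cases ?_ (fun i => ?_) α
    · exact (defMat4_zero_zero q).symm
    · simp [coord, defMat4_succ_zero]
  · rw [basis4_succ, fderiv_lagMap hq]
    refine Fin.cases ?_ (fun i => ?_) α
    · exact (defMat4_zero_succ q j).symm
    · simp [coord, defMat4_succ_succ]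

theorem fderiv_apply_eq_sum_coord (f : TimeSpace → ℝ) (q w : TimeSpace) :
    fderiv ℝ f q w = ∑ α, coord w α * pd α f q := by
  rw [Fin.sum_univ_succ]
  exact fderiv_apply_eq_pd f q w.1 w.2

/-- The chain rule for `f ∘ invMap`, in coordinates. -/
theorem sum_defMat4_pd_comp_invMap (hq : q ∈ M.labelDomain) {f : TimeSpace → ℝ}
    (hf : DifferentiableAt ℝ f q) (β : Fin 4) :
    ∑ α, M.defMat4 q α β * pd α (fun p => f (M.invMap p)) (M.lagMap q) = pd β f q := by
  have h := fderiv_comp_invMap hq hf (basis4 β)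
  rw [fderiv_apply_eq_sum_coord] at h
  exact (Finset.sum_congr rfl fun α _ => by rw [fderiv_lagMap_basis4 hq]).trans h

theorem hasFDerivAt_coord (q : TimeSpace) (γ : Fin 4) :
    ∃ L : TimeSpace →L[ℝ] ℝ, HasFDerivAt (fun r => coord r γ) L q ∧ ∀ w, L w = coord w γ := by
  refine Fin.cases ?_ (fun k => ?_) γ
  · exact ⟨_, hasFDerivAt_fst, fun w => rfl⟩
  · exact ⟨_, hasFDerivAt_pi'.1 hasFDerivAt_snd k, fun w => rfl⟩

theorem coord_basis4 (γ β : Fin 4) :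
    coord (basis4 β) γ = (1 : Matrix (Fin 4) (Fin 4) ℝ) γ β := by
  refine Fin.cases ?_ (fun j => ?_) β <;> refine Fin.cases ?_ (fun k => ?_) γ
  · simp [coord, basis4]
  · simp [coord, basis4]
  · simp [coord, basis4, (Fin.succ_ne_zero j).symm]
  · simp [coord, basis4, Matrix.one_apply, Pi.single_apply]

/-- This is the chain rule applied to the coordinate functions themselves. -/
theorem invDefMat4_mul_defMat4 (hq : q ∈ M.labelDomain) :
    M.invDefMat4 (M.lagMap q) * M.defMat4 q = 1 := by
  ext γ β
  obtain ⟨L, hL, hLw⟩ := hasFDerivAt_coord q γ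
  have h := sum_defMat4_pd_comp_invMap hq hL.differentiableAt β
  rw [pd, hL.fderiv, hLw, coord_basis4] at h
  rw [Matrix.mul_apply, ← h]
  exact Finset.sum_congr rfl fun α _ => mul_comm _ _

theorem pd_comp_invMap (hq : q ∈ M.labelDomain) {f : TimeSpace → ℝ}
    (hf : DifferentiableAt ℝ f q) (α : Fin 4) :
    pd α (fun p => f (M.invMap p)) (M.lagMap q)
      = ∑ γ, M.invDefMat4 (M.lagMap q) γ α * pd γ f q := by
  have hmul := mul_eq_one_comm.1 (invDefMat4_mul_defMat4 hq)
  simp_rw [← sum_defMat4_pd_comp_invMap hq hf, Finset.mul_sum]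
  rw [Finset.sum_comm]
  have hα : ∀ δ, ∑ γ, M.defMat4 q δ γ * M.invDefMat4 (M.lagMap q) γ α = if δ = α then 1 else 0 := by
    intro δ
    rw [← Matrix.mul_apply, hmul, Matrix.one_apply]
  have : ∀ δ, ∑ γ, M.invDefMat4 (M.lagMap q) γ α *
      (M.defMat4 q δ γ * pd δ (fun p => f (M.invMap p)) (M.lagMap q))
      = (if δ = α then 1 else 0) * pd δ (fun p => f (M.invMap p)) (M.lagMap q) := by
    intro δ
    rw [← hα, Finset.sum_mul]
    exact Finset.sum_congr rfl fun γ _ => by ring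
  simp [this]

/-- The adjugate of an invertible matrix is its determinant times its inverse; here the inverse is
x_{αβ} and the determinant is 1/J. -/
theorem cofac_invDefMat4 (hq : q ∈ M.labelDomain) (α β : Fin 4) :
    cofac (M.invDefMat4 (M.lagMap q)) β α = M.defMat4 q α β / M.jac q := by
  have h := invDefMat4_mul_defMat4 hq
  have hJ := (jac_pos hq).ne'
  have hd : (M.invDefMat4 (M.lagMap q)).det * M.jac q = 1 := by
    rw [← det_defMat4, ← Matrix.det_mul, h, Matrix.det_one]
  have hadj : (M.invDefMat4 (M.lagMap q)).adjugate
      = (M.invDefMat4 (M.lagMap q)).det • M.defMat4 q := by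
    calc (M.invDefMat4 (M.lagMap q)).adjugate
        = (M.invDefMat4 (M.lagMap q)).adjugate * (M.invDefMat4 (M.lagMap q) * M.defMat4 q) := by
          rw [h, mul_one]
      _ = _ := by rw [← mul_assoc, Matrix.adjugate_mul, Matrix.smul_mul, one_mul]
  rw [cofac, Matrix.transpose_apply, hadj, Matrix.smul_apply, smul_eq_mul,
    eq_div_iff hJ, mul_right_comm, hd, one_mul]

/-- The Piola identity for `x_{αβ}`: `∂_α x_{αβ} = J⁻¹ ∂J/∂x₀^β`. -/
theorem sum_pd_defMat4 (hq : q ∈ M.labelDomain) (β : Fin 4) :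
    M.jac q * ∑ α, pd α (fun p => M.defMat4 (M.invMap p) α β) (M.lagMap q) = pd β M.jac q := by
  have hJ := (jac_pos hq).ne'
  have h := invDefMat4_mul_defMat4 hq
  have hdet : M.jac = fun r => (M.defMat4 r).det := funext fun r => (det_defMat4 r).symm
  have hadj : (M.defMat4 q).adjugate = M.jac q • M.invDefMat4 (M.lagMap q) := by
    calc (M.defMat4 q).adjugate
        = M.invDefMat4 (M.lagMap q) * M.defMat4 q * (M.defMat4 q).adjugate := by
          rw [h, one_mul]
      _ = _ := by rw [mul_assoc, Matrix.mul_adjugate, det_defMat4, Matrix.mul_smul, mul_one]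
  have hpd : pd β M.jac q = pd β (fun r => (M.defMat4 r).det) q := by rw [← hdet]
  rw [hpd, pd_det (differentiableAt_defMat4 hq), hadj, Matrix.smul_mul, Matrix.trace_smul,
    smul_eq_mul]
  congr 1
  simp only [Matrix.trace, Matrix.diag, Matrix.mul_apply, Matrix.of_apply]
  rw [Finset.sum_comm]
  refine Finset.sum_congr rfl fun α _ => ?_
  rw [pd_comp_invMap hq (differentiableAt_defMat4 hq α β)]
  exact Finset.sum_congr rfl fun γ _ => by
    congr 1
    -- Jacobi's formula produces ∂_β x_{αγ}, the chain rule ∂_γ x_{αβ}; their equality is where X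
    -- being C² enters.
    exact pd_comm (contDiffAt_coord_lagMap hq α) γ β

/-- The Piola identity: the space-time divergence of the transformed four-vector. -/
theorem jac_mul_div4_push (hq : q ∈ M.labelDomain) {Λ : TimeSpace → Fin 4 → ℝ}
    (hΛ : ∀ β, DifferentiableAt ℝ (fun r => Λ r β) q) :
    M.jac q * div4 (fun p α => ∑ β, Λ (M.invMap p) β *
        (M.defMat4 (M.invMap p) α β / M.jac (M.invMap p))) (M.lagMap q) = div4 Λ q := by
  have hJ := (jac_pos hq).ne'
  have hJd := differentiableAt_jac hq
  have hg : ∀ β, DifferentiableAt ℝ (fun r => Λ r β * (M.jac r)⁻¹) q := fun β =>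
    (hΛ β).mul (hJd.fun_inv hJ)
  have hterm : ∀ α, pd α (fun p => ∑ β, Λ (M.invMap p) β *
        (M.defMat4 (M.invMap p) α β / M.jac (M.invMap p))) (M.lagMap q)
      = ∑ β, (M.defMat4 q α β * pd α (fun p => Λ (M.invMap p) β * (M.jac (M.invMap p))⁻¹)
            (M.lagMap q)
          + Λ q β * (M.jac q)⁻¹ *
            pd α (fun p => M.defMat4 (M.invMap p) α β) (M.lagMap q)) := by
    intro α
    have hd1 := fun β => differentiableAt_comp_invMap hq (hg β)
    have hd2 := fun β => differentiableAt_comp_invMap hq (differentiableAt_defMat4 hq α β)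
    have e : (fun p => ∑ β, Λ (M.invMap p) β *
        (M.defMat4 (M.invMap p) α β / M.jac (M.invMap p)))
        = fun p => ∑ β, M.defMat4 (M.invMap p) α β *
          (Λ (M.invMap p) β * (M.jac (M.invMap p))⁻¹) := by
      funext p
      exact Finset.sum_congr rfl fun β _ => by rw [div_eq_mul_inv]; ring
    rw [e, pd_sum fun β _ => (hd2 β).fun_mul (hd1 β)]
    refine Finset.sum_congr rfl fun β _ => ?_
    rw [pd_mul (hd2 β) (hd1 β), invMap_lagMap hq]
    ring
  rw [div4, Finset.sum_congr rfl fun α _ => hterm α, Finset.sum_comm, Finset.mul_sum, div4]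
  refine Finset.sum_congr rfl fun β _ => ?_
  -- The first group of terms is the label derivative of Λ_β/J; the second is Λ_β/J² times the label
  -- derivative of J, which cancels the contribution from differentiating 1/J.
  rw [Finset.sum_add_distrib, ← Finset.mul_sum, sum_defMat4_pd_comp_invMap hq (hg β), mul_add,
    mul_left_comm, sum_pd_defMat4 hq, pd_mul (hΛ β) (hJd.fun_inv hJ), pd_inv hJd hJ]
  field_simp
  ring

end Flow

/-! ### Vector and dyadic identities -/

/-- The curl of V × B contains V ∇·B, which the added term removes exactly; hence B need not be
solenoidal. -/
theorem curl_crossProduct {V B : TimeSpace → V3} {p : TimeSpace}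
    (hV : ∀ k, DifferentiableAt ℝ (fun r => V r k) p)
    (hB : ∀ k, DifferentiableAt ℝ (fun r => B r k) p) :
    -curl (fun r => crossProduct (V r) (B r)) p + div B p • V p
      = div V p • B p - advect (B p) V p + advect (V p) B p := by
  have key : ∀ (α : Fin 4) (i j k l : Fin 3),
      pd α (fun r => V r i * B r j - V r k * B r l) p
        = V p i * pd α (fun r => B r j) p + pd α (fun r => V r i) p * B p j
          - (V p k * pd α (fun r => B r l) p + pd α (fun r => V r k) p * B p l) := by
    intro α i j k l
    rw [pd_sub ((hV i).fun_mul (hB j)) ((hV k).fun_mul (hB l)), pd_mul (hV i) (hB j),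
      pd_mul (hV k) (hB l)]
  have h0 : ∀ r, crossProduct (V r) (B r) 0 = V r 1 * B r 2 - V r 2 * B r 1 := fun r => by
    simp [cross_apply]
  have h1 : ∀ r, crossProduct (V r) (B r) 1 = V r 2 * B r 0 - V r 0 * B r 2 := fun r => by
    simp [cross_apply]
  have h2 : ∀ r, crossProduct (V r) (B r) 2 = V r 0 * B r 1 - V r 1 * B r 0 := fun r => by
    simp [cross_apply]
  have s0 : (Fin.succ 0 : Fin 4) = 1 := rfl
  have s1 : (Fin.succ 1 : Fin 4) = 2 := rfl
  have s2 : (Fin.succ 2 : Fin 4) = 3 := rfl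
  ext k
  fin_cases k <;>
    simp only [curl, div, advect, Fin.sum_univ_three, Pi.add_apply, Pi.neg_apply, Pi.sub_apply,
      Pi.smul_apply, smul_eq_mul, h0, h1, h2, key, s0, s1, s2, Fin.zero_eta, Fin.mk_one,
      Fin.reduceFinMk, Matrix.cons_val] <;>
    ring

/-- Contracting a dyad with the metric FᵀF is the Euclidean inner product of the pushed-forward
vectors, the form in which the magnetic terms are compared. -/
theorem sum_gram_mul_vecMulVec (F : Matrix (Fin 3) (Fin 3) ℝ) (a b : V3) :
    ∑ j, ∑ s, (Fᵀ * F) j s * Matrix.vecMulVec a b j s = (F *ᵥ a) ⬝ᵥ (F *ᵥ b) := by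
  simp only [Fin.sum_univ_three, Matrix.mul_apply, Matrix.transpose_apply, Matrix.vecMulVec_apply,
    dotProduct, Matrix.mulVec]
  ring

theorem vecMulVec_combination (a b c : V3) (d : ℝ) :
    Matrix.vecMulVec a b + d • Matrix.vecMulVec b b - Matrix.vecMulVec c b
      = Matrix.vecMulVec (a + d • b - c) b := by
  ext i j
  simp only [Matrix.sub_apply, Matrix.add_apply, Matrix.smul_apply, Matrix.vecMulVec_apply,
    Pi.sub_apply, Pi.add_apply, Pi.smul_apply, smul_eq_mul]
  ring

/-- The four-divergence, split into its time and space parts. -/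
theorem div4_eq (Λ : TimeSpace → Fin 4 → ℝ) (q : TimeSpace) :
    div4 Λ q = pd 0 (fun r => Λ r 0) q + div (fun r i => Λ r i.succ) q :=
  Fin.sum_univ_succ _

/-! ### Fields on labels and product rules -/

section label

variable {q : TimeSpace}

/-- Differentiation of a field that depends on the label only. -/
theorem hasDerivAt_comp_line {f : V3 → ℝ} (hf : DifferentiableAt ℝ f q.2) (a : V3) :
    HasDerivAt (fun τ : ℝ => f (q.2 + τ • a)) (∑ i, a i * pd i.succ (fun r => f r.2) q) 0 := by
  have hs : HasFDerivAt (fun r : TimeSpace => f r.2)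
      ((fderiv ℝ f q.2).comp (ContinuousLinearMap.snd ℝ ℝ V3)) q :=
    hf.hasFDerivAt.comp q hasFDerivAt_snd
  have h1 := fderiv_apply_eq_pd (fun r => f r.2) q 0 a
  rw [hs.fderiv, zero_mul, zero_add] at h1
  rw [← h1]
  have hl : HasDerivAt (fun τ : ℝ => q.2 + τ • a) a 0 := by
    simpa using ((hasDerivAt_id (0 : ℝ)).smul_const a).const_add q.2
  exact HasFDerivAt.comp_hasDerivAt (0 : ℝ) (by simpa using hf.hasFDerivAt) hl

theorem pd_zero_comp_snd {f : V3 → ℝ} (hf : DifferentiableAt ℝ f q.2) :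
    pd 0 (fun r => f r.2) q = 0 := by
  have hs : HasFDerivAt (fun r : TimeSpace => f r.2)
      ((fderiv ℝ f q.2).comp (ContinuousLinearMap.snd ℝ ℝ V3)) q :=
    hf.hasFDerivAt.comp q hasFDerivAt_snd
  rw [pd, hs.fderiv, basis4_zero]
  simp

theorem differentiableAt_comp_snd {f : V3 → ℝ} (hf : DifferentiableAt ℝ f q.2) :
    DifferentiableAt ℝ (fun r : TimeSpace => f r.2) q :=
  hf.comp q differentiableAt_snd

theorem pd_mulVec {F : TimeSpace → Matrix (Fin 3) (Fin 3) ℝ} {b : TimeSpace → V3}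
    (hF : ∀ i j, DifferentiableAt ℝ (fun r => F r i j) q)
    (hb : ∀ j, DifferentiableAt ℝ (fun r => b r j) q) (α : Fin 4) (k : Fin 3) :
    pd α (fun r => (F r *ᵥ b r) k) q
      = ∑ j, (F q k j * pd α (fun r => b r j) q + pd α (fun r => F r k j) q * b q j) := by
  refine (pd_sum (s := Finset.univ) (f := fun j r => F r k j * b r j)
    (fun j _ => (hF k j).fun_mul (hb j)) α).trans ?_
  exact Finset.sum_congr rfl fun j _ => pd_mul (hF k j) (hb j) α

theorem differentiableAt_mulVec {F : TimeSpace → Matrix (Fin 3) (Fin 3) ℝ} {b : TimeSpace → V3}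
    (hF : ∀ i j, DifferentiableAt ℝ (fun r => F r i j) q)
    (hb : ∀ j, DifferentiableAt ℝ (fun r => b r j) q) (k : Fin 3) :
    DifferentiableAt ℝ (fun r => (F r *ᵥ b r) k) q :=
  DifferentiableAt.fun_sum (u := Finset.univ) (A := fun j r => F r k j * b r j)
    fun j _ => (hF k j).fun_mul (hb j)

theorem div_smul {f : TimeSpace → ℝ} {F : TimeSpace → V3} (hf : DifferentiableAt ℝ f q)
    (hF : ∀ j, DifferentiableAt ℝ (fun r => F r j) q) :
    div (fun r => f r • F r) q = f q * div F q + ∑ j, F q j * pd j.succ f q := by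
  rw [div, div, Finset.mul_sum, ← Finset.sum_add_distrib]
  refine Finset.sum_congr rfl fun j _ => ?_
  refine (pd_mul hf (hF j) j.succ).trans ?_
  ring

end label

/-! ### Pullback of the Eulerian condition to labels -/

namespace Flow

variable {M : Flow} {q : TimeSpace} {ξ : TimeSpace → V3}

theorem differentiableAt_ρ₀ (hq : q ∈ M.labelDomain) : DifferentiableAt ℝ M.ρ₀ q.2 :=
  (M.contDiffOn_ρ₀.contDiffAt (M.isOpen_labels.mem_nhds hq.2)).differentiableAt (by norm_num)

theorem differentiableAt_S₀ (hq : q ∈ M.labelDomain) : DifferentiableAt ℝ M.S₀ q.2 :=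
  (M.contDiffOn_S₀.contDiffAt (M.isOpen_labels.mem_nhds hq.2)).differentiableAt (by norm_num)

theorem differentiableAt_B₀ (hq : q ∈ M.labelDomain) (k : Fin 3) :
    DifferentiableAt ℝ (fun a => M.B₀ a k) q.2 :=
  differentiableAt_pi.1 ((M.contDiffOn_B₀.contDiffAt
    (M.isOpen_labels.mem_nhds hq.2)).differentiableAt (by norm_num)) k

theorem differentiableAt_dt_X (hq : q ∈ M.labelDomain) (k : Fin 3) :
    DifferentiableAt ℝ (fun r => dt M.X r k) q :=
  differentiableAt_pd (contDiffAt_X_apply hq k) 0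

theorem differentiableAt_ε {ρ : ℝ} (hρ : 0 < ρ) (S : ℝ) : DifferentiableAt ℝ M.ε (ρ, S) := by
  have hmem : ((ρ, S) : ℝ × ℝ) ∈ Set.Ioi (0 : ℝ) ×ˢ (Set.univ : Set ℝ) := ⟨hρ, Set.mem_univ S⟩
  exact (M.contDiffOn_ε.contDiffAt
    ((isOpen_Ioi.prod isOpen_univ).mem_nhds hmem)).differentiableAt (by norm_num)

theorem pd_defMat_comm (hq : q ∈ M.labelDomain) (k j s : Fin 3) :
    pd s.succ (fun r => M.defMat r k j) q = pd j.succ (fun r => M.defMat r k s) q :=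
  pd_comm (contDiffAt_X_apply hq k) s.succ j.succ

theorem canonical_relabelling (M : Flow) (ξ : TimeSpace → V3) (q : TimeSpace) :
    M.canonical (relabelling ξ) q = -(M.defMat q *ᵥ ξ q) := by
  ext k
  rw [canonical, Fin.sum_univ_succ]
  simp [Generator.V4, relabelling, defMat, Matrix.mulVec, dotProduct, mul_comm]

theorem Vhat_eq (M : Flow) (ξ : TimeSpace → V3) :
    M.Vhat ξ = fun p => -(M.defMat (M.invMap p) *ᵥ ξ (M.invMap p)) :=
  funext fun p => canonical_relabelling M ξ (M.invMap p)

/-- This is the space-time Piola identity for a four-vector with zero time component; the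
pushforward keeps that component zero because x_{0j} = 0. -/
theorem div_push (hq : q ∈ M.labelDomain) {A : TimeSpace → V3}
    (hA : ∀ j, DifferentiableAt ℝ (fun r => A r j) q) :
    M.jac q * div (fun p => (M.jac (M.invMap p))⁻¹ •
      (M.defMat (M.invMap p) *ᵥ A (M.invMap p))) (M.lagMap q) = div A q := by
  have h := jac_mul_div4_push hq (Λ := fun r => Matrix.vecCons 0 (A r))
    (fun β => Fin.cases (differentiableAt_const (0 : ℝ)) hA β)
  have h0 : ∀ p : TimeSpace, ∑ β, (Matrix.vecCons 0 (A (M.invMap p)) : Fin 4 → ℝ) β *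
      (M.defMat4 (M.invMap p) 0 β / M.jac (M.invMap p)) = 0 := fun p => by
    simp [Fin.sum_univ_succ _, defMat4_zero_succ]
  have hs : ∀ (i : Fin 3) (p : TimeSpace),
      ∑ β, (Matrix.vecCons 0 (A (M.invMap p)) : Fin 4 → ℝ) β *
      (M.defMat4 (M.invMap p) i.succ β / M.jac (M.invMap p))
      = ((M.jac (M.invMap p))⁻¹ • (M.defMat (M.invMap p) *ᵥ A (M.invMap p))) i := fun i p => by
    rw [Fin.sum_univ_succ]
    simp only [Matrix.cons_val_zero, zero_mul, zero_add, Matrix.cons_val_succ, defMat4_succ_succ,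
      Pi.smul_apply, smul_eq_mul, Matrix.mulVec, dotProduct, Finset.mul_sum]
    exact Finset.sum_congr rfl fun j _ => by rw [div_eq_mul_inv]; ring
  rw [div4_eq, div4_eq] at h
  simp only [div, h0, hs, pd_const, zero_add, Matrix.cons_val_zero, Matrix.cons_val_succ] at h
  exact h

/-- Since ρ = ρ₀/J, the flux ρV̂ is F(-ρ₀ξ)/J, already of the form to which the Piola identity
applies. -/
theorem div_ρ_smul_Vhat (hq : q ∈ M.labelDomain)
    (hξ : ∀ j, DifferentiableAt ℝ (fun r => ξ r j) q) :
    M.jac q * div (fun p => M.ρ p • M.Vhat ξ p) (M.lagMap q)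
      = -div (fun r => M.ρ₀ r.2 • ξ r) q := by
  have hρ := differentiableAt_comp_snd (differentiableAt_ρ₀ hq)
  have h := div_push hq (A := fun r => -(M.ρ₀ r.2 • ξ r)) fun j => (hρ.fun_mul (hξ j)).fun_neg
  have e : (fun p => M.ρ p • M.Vhat ξ p) = fun p => (M.jac (M.invMap p))⁻¹ •
      (M.defMat (M.invMap p) *ᵥ (fun r : TimeSpace => -(M.ρ₀ r.2 • ξ r)) (M.invMap p)) := by
    funext p
    rw [Vhat_eq, ρ, Matrix.mulVec_neg, Matrix.mulVec_smul, div_eq_inv_mul, mul_smul]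
    simp only [smul_neg]
  rw [e, h]
  simp [div, pd_neg]

/-- Here V̂ is written as F(-Jξ)/J. This needs J ≠ 0, so the two fields are identified only near the
point, which suffices for derivatives. -/
theorem div_Vhat (hq : q ∈ M.labelDomain)
    (hξ : ∀ j, DifferentiableAt ℝ (fun r => ξ r j) q) :
    M.jac q * div (M.Vhat ξ) (M.lagMap q) = -div (fun r => M.jac r • ξ r) q := by
  have h := div_push hq (A := fun r => -(M.jac r • ξ r))
    fun j => ((differentiableAt_jac hq).fun_mul (hξ j)).fun_neg
  obtain ⟨-, -, -, hev⟩ := hasFDerivAt_invMap hq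
  have e : ∀ i : Fin 3, (fun p => M.Vhat ξ p i) =ᶠ[𝓝 (M.lagMap q)]
      fun p => ((M.jac (M.invMap p))⁻¹ • (M.defMat (M.invMap p) *ᵥ
        (fun r : TimeSpace => -(M.jac r • ξ r)) (M.invMap p))) i := by
    intro i
    filter_upwards [hev] with p hp
    rw [Vhat_eq, ← smul_neg, Matrix.mulVec_smul, inv_smul_smul₀ (jac_pos hp.1).ne',
      Matrix.mulVec_neg]
  have e' : div (M.Vhat ξ) (M.lagMap q) = div (fun p => ((M.jac (M.invMap p))⁻¹ •
      (M.defMat (M.invMap p) *ᵥ (fun r : TimeSpace => -(M.jac r • ξ r)) (M.invMap p))))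
      (M.lagMap q) :=
    Finset.sum_congr rfl fun i _ => pd_congr (e i) i.succ
  rw [e', h]
  simp [div, pd_neg]

theorem Vhat_dotProduct_grad_S (hq : q ∈ M.labelDomain) :
    M.Vhat ξ (M.lagMap q) ⬝ᵥ grad M.S (M.lagMap q)
      = -(ξ q ⬝ᵥ grad (fun r => M.S₀ r.2) q) := by
  have h := sum_mulVec_pd_comp_invMap hq (differentiableAt_comp_snd (differentiableAt_S₀ hq)) (ξ q)
  rw [Vhat_eq, neg_dotProduct]
  simp only [invMap_lagMap hq]
  exact congrArg Neg.neg h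

/-- Differentiating Fξ at fixed label gives F ∂ξ/∂t + (∂F/∂t)ξ. By symmetry of second derivatives
the last term is ξ·∇₀x_t, which the advection of u along V̂ cancels. -/
theorem materialDeriv_Vhat_sub (hq : q ∈ M.labelDomain)
    (hξ : ∀ j, DifferentiableAt ℝ (fun r => ξ r j) q) :
    M.materialDeriv (M.Vhat ξ) (M.lagMap q) - advect (M.Vhat ξ (M.lagMap q)) M.u (M.lagMap q)
      = -(M.defMat q *ᵥ dt ξ q) := by
  have hF := differentiableAt_defMat hq
  ext k
  have h1 := material_pd_comp_invMap hq (differentiableAt_mulVec hF hξ k)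
  have h2 := sum_mulVec_pd_comp_invMap hq (differentiableAt_dt_X hq k) (ξ q)
  rw [pd_mulVec hF hξ] at h1
  have hc : ∀ s : Fin 3, pd s.succ (fun r => dt M.X r k) q = pd 0 (fun r => M.defMat r k s) q :=
    fun s => pd_comm (contDiffAt_X_apply hq k) s.succ 0
  simp only [hc] at h2
  simp only [Vhat_eq, materialDeriv, dt, advect, u, Pi.sub_apply, Pi.add_apply, Pi.neg_apply,
    pd_neg, invMap_lagMap hq] at h1 h2 ⊢
  simp only [Finset.sum_add_distrib, neg_mul, mul_neg, Finset.sum_neg_distrib] at h1 ⊢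
  simp only [dt, Matrix.mulVec, dotProduct, mul_comm] at h1 h2 ⊢
  linarith

/-- The magnetic term: `J [-∇×(V̂×B) + V̂ ∇·B] = -F [ξ·∇₀B₀ + B₀ ∇₀·ξ - B₀·∇₀ξ]`. -/
theorem jac_smul_magnetic (hq : q ∈ M.labelDomain)
    (hξ : ∀ j, DifferentiableAt ℝ (fun r => ξ r j) q) :
    M.jac q • (-curl (fun r => crossProduct (M.Vhat ξ r) (M.B r)) (M.lagMap q)
        + div M.B (M.lagMap q) • M.Vhat ξ (M.lagMap q))
      = -(M.defMat q *ᵥ (advect (ξ q) (fun r => M.B₀ r.2) q + div ξ q • M.B₀ q.2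
          - advect (M.B₀ q.2) ξ q)) := by
  have hJ := (jac_pos hq).ne'
  have hJd := differentiableAt_jac hq
  have hF := differentiableAt_defMat hq
  have hB₀ : ∀ k, DifferentiableAt ℝ (fun r : TimeSpace => M.B₀ r.2 k) q := fun k =>
    differentiableAt_comp_snd (differentiableAt_B₀ hq k)
  have hFξ := differentiableAt_mulVec hF hξ
  have hFB := differentiableAt_mulVec (b := fun r : TimeSpace => M.B₀ r.2) hF hB₀
  have hJFB : ∀ k, DifferentiableAt ℝ (fun r : TimeSpace =>
      (M.jac r)⁻¹ * (M.defMat r *ᵥ M.B₀ r.2) k) q := fun k => (hJd.fun_inv hJ).fun_mul (hFB k)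
  have hV : ∀ k, DifferentiableAt ℝ (fun p => M.Vhat ξ p k) (M.lagMap q) := fun k => by
    rw [Vhat_eq]
    exact (differentiableAt_comp_invMap hq (hFξ k)).fun_neg
  have hB : ∀ k, DifferentiableAt ℝ (fun p => M.B p k) (M.lagMap q) := fun k =>
    differentiableAt_comp_invMap hq (hJFB k)
  rw [curl_crossProduct hV hB]
  ext k
  have h1 : M.jac q * div (M.Vhat ξ) (M.lagMap q)
      = -(M.jac q * div ξ q + ∑ j, ξ q j * pd j.succ M.jac q) := by
    rw [div_Vhat hq hξ, div_smul hJd hξ]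
  have hBq : M.B (M.lagMap q) = (M.jac q)⁻¹ • (M.defMat q *ᵥ M.B₀ q.2) := by
    rw [B, invMap_lagMap hq]
  have hVq : M.Vhat ξ (M.lagMap q) = -(M.defMat q *ᵥ ξ q) := by
    simp only [Vhat_eq, invMap_lagMap hq]
  have h2 : M.jac q * advect (M.B (M.lagMap q)) (M.Vhat ξ) (M.lagMap q) k
      = -∑ s, M.B₀ q.2 s * ∑ j, (M.defMat q k j * pd s.succ (fun r => ξ r j) q
          + pd s.succ (fun r => M.defMat r k j) q * ξ q j) := by
    have h := sum_mulVec_pd_comp_invMap hq (hFξ k) (M.B₀ q.2)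
    simp only [pd_mulVec hF hξ] at h
    rw [← h]
    simp only [advect, hBq, Vhat_eq, Pi.neg_apply, pd_neg, Pi.smul_apply, smul_eq_mul, mul_neg,
      Finset.sum_neg_distrib, Finset.mul_sum]
    refine congrArg Neg.neg (Finset.sum_congr rfl fun i _ => ?_)
    rw [mul_assoc, mul_inv_cancel_left₀ hJ]
  have h3 : M.jac q * advect (M.Vhat ξ (M.lagMap q)) M.B (M.lagMap q) k
      = -∑ s, ξ q s * (∑ j, (M.defMat q k j * pd s.succ (fun r => M.B₀ r.2 j) q
          + pd s.succ (fun r => M.defMat r k j) q * M.B₀ q.2 j)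
          - pd s.succ M.jac q / M.jac q * (M.defMat q *ᵥ M.B₀ q.2) k) := by
    have h := sum_mulVec_pd_comp_invMap hq (hJFB k) (ξ q)
    have e : ∀ s : Fin 3, pd s.succ (fun r => (M.jac r)⁻¹ * (M.defMat r *ᵥ M.B₀ r.2) k) q
        = (M.jac q)⁻¹ * (∑ j, (M.defMat q k j * pd s.succ (fun r => M.B₀ r.2 j) q
          + pd s.succ (fun r => M.defMat r k j) q * M.B₀ q.2 j)
          - pd s.succ M.jac q / M.jac q * (M.defMat q *ᵥ M.B₀ q.2) k) := fun s => by
      rw [pd_mul (hJd.fun_inv hJ) (hFB k),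
        pd_mulVec (b := fun r : TimeSpace => M.B₀ r.2) hF hB₀, pd_inv hJd hJ]
      field_simp
      ring
    simp only [e] at h
    have h' : advect (M.Vhat ξ (M.lagMap q)) M.B (M.lagMap q) k
        = -∑ i, (M.defMat q *ᵥ ξ q) i * pd i.succ (fun p => (M.jac (M.invMap p))⁻¹ *
          (M.defMat (M.invMap p) *ᵥ M.B₀ (M.invMap p).2) k) (M.lagMap q) := by
      simp only [advect, hVq, Pi.neg_apply, neg_mul, Finset.sum_neg_distrib]
      rfl
    rw [h', h, mul_neg, Finset.mul_sum]
    refine congrArg Neg.neg (Finset.sum_congr rfl fun i _ => ?_)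
    rw [mul_left_comm, mul_inv_cancel_left₀ hJ]
  -- Two cancellations finish the proof: derivatives of F drop out because ∂F_{kj}/∂x₀^s is
  -- symmetric in j and s, and the gradients of J from ∇·V̂ and from V̂·∇B are opposite.
  have hc := pd_defMat_comm hq k
  have h10 := hc 1 0
  have h20 := hc 2 0
  have h21 := hc 2 1
  simp only [Pi.smul_apply, Pi.add_apply, Pi.sub_apply, smul_eq_mul, mul_add, mul_sub, h2, h3]
  rw [← mul_assoc, h1, hBq]
  simp only [Pi.smul_apply, smul_eq_mul, Pi.neg_apply, Matrix.mulVec, dotProduct, advect, div,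
    Fin.sum_univ_three, Pi.add_apply, Pi.sub_apply, h10, h20, h21]
  field_simp
  ring

/-- Both forms of the condition have proportional left-hand sides. -/
theorem lagrangianLHS_eq (hq : q ∈ M.labelDomain)
    (hξ : ∀ j, DifferentiableAt ℝ (fun r => ξ r j) q) :
    M.lagrangianLHS ξ q = M.jac q * M.eulerianLHS ξ (M.lagMap q) := by
  have hJ := (jac_pos hq).ne'
  have hρ₀ := (M.ρ₀_pos q.2 hq.2).ne'
  have hρq : M.ρ (M.lagMap q) = M.ρ₀ q.2 / M.jac q := by rw [ρ, invMap_lagMap hq]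
  have hSq : M.S (M.lagMap q) = M.S₀ q.2 := by rw [S, invMap_lagMap hq]
  have huq : M.u (M.lagMap q) = dt M.X q := by rw [u, invMap_lagMap hq]
  have hBq : M.B (M.lagMap q) = (M.jac q)⁻¹ • (M.defMat q *ᵥ M.B₀ q.2) := by
    rw [B, invMap_lagMap hq]
  have hdt : dt (fun r => M.ρ₀ r.2 • ξ r) q = M.ρ₀ q.2 • dt ξ q := by
    ext k
    refine (pd_mul (differentiableAt_comp_snd (differentiableAt_ρ₀ hq)) (hξ k) 0).trans ?_
    rw [pd_zero_comp_snd (differentiableAt_ρ₀ hq), zero_mul, add_zero]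
    rfl
  have h1 := div_ρ_smul_Vhat hq hξ
  have h4 := jac_smul_magnetic hq hξ
  rw [lagrangianLHS, eulerianLHS]
  -- Unfolding the pressure turns (ε + p)/ρ into h; after that the terms match one by one.
  rw [vecMulVec_combination, sum_gram_mul_vecMulVec, hdt, Matrix.mulVec_smul,
    ← neg_eq_iff_eq_neg.2 h1, Vhat_dotProduct_grad_S hq, materialDeriv_Vhat_sub hq hξ, hBq,
    ← neg_eq_iff_eq_neg.2 h4, h, T, temperature, pressure, hρq, hSq, huq]
  simp only [smul_dotProduct, neg_dotProduct, smul_eq_mul,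
    dotProduct_comm (dt M.X q)]
  rw [dotProduct_comm (M.defMat q *ᵥ M.B₀ q.2)]
  have hμ := M.μ₀_pos.ne'
  have hx : (M.lagMap q).2 = M.X q := rfl
  rw [hx]
  field_simp
  ring

/-! ### The extended operator acting on the Lagrangian density -/

theorem relabelling_V4 (ξ : TimeSpace → V3) (q : TimeSpace) :
    (relabelling ξ).V4 q = Matrix.vecCons 0 (ξ q) := rfl

/-- For a relabelling, the prolongation is `-(D_α ξ · ∇₀) x`. -/
theorem prolong_relabelling (hq : q ∈ M.labelDomain)
    (hξ : ∀ j, DifferentiableAt ℝ (fun r => ξ r j) q) (α : Fin 4) :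
    M.prolong (relabelling ξ) α q = -(M.defMat q *ᵥ fun s => pd α (fun r => ξ r s) q) := by
  ext k
  have h : pd α (fun r => M.canonical (relabelling ξ) r k) q
      = -∑ j, (M.defMat q k j * pd α (fun r => ξ r j) q
          + pd α (fun r => M.defMat r k j) q * ξ q j) := by
    rw [← pd_mulVec (differentiableAt_defMat hq) hξ, ← pd_neg]
    simp only [canonical_relabelling, Pi.neg_apply]
  -- The correction V^β D_β D_α x equals (D_α F)ξ, which cancels the term in D_α V̂ where F is
  -- differentiated.
  have hc : ∀ s : Fin 3, pd s.succ (fun r => pd α (fun r' => M.X r' k) r) q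
      = pd α (fun r => M.defMat r k s) q := fun s =>
    pd_comm (contDiffAt_X_apply hq k) s.succ α
  rw [prolong, h, Fin.sum_univ_succ (n := 3)]
  simp only [relabelling_V4, Matrix.cons_val_zero, Matrix.cons_val_succ, zero_mul, zero_add, hc,
    Finset.sum_add_distrib, Pi.neg_apply, Matrix.mulVec, dotProduct]
  simp only [mul_comm]
  ring

theorem extended_relabelling (hq : q ∈ M.labelDomain)
    (hξ : ∀ j, DifferentiableAt ℝ (fun r => ξ r j) q) :
    M.extended (relabelling ξ) q = (ξ q, 0, 0, -(M.defMat q *ᵥ dt ξ q),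
      -(M.defMat q * Matrix.of fun s j : Fin 3 => pd j.succ (fun r => ξ r s) q)) := by
  rw [extended, prolong_relabelling hq hξ]
  refine Prod.ext rfl (Prod.ext rfl (Prod.ext rfl (Prod.ext rfl ?_)))
  ext k j
  simp only [Matrix.of_apply, prolong_relabelling hq hξ, Pi.neg_apply, Matrix.neg_apply,
    Matrix.mul_apply, Matrix.mulVec, dotProduct]

theorem hasDerivAt_dotProduct {f g : ℝ → V3} {f' g' : V3} {t : ℝ}
    (hf : ∀ k, HasDerivAt (fun s => f s k) (f' k) t)
    (hg : ∀ k, HasDerivAt (fun s => g s k) (g' k) t) :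
    HasDerivAt (fun s => f s ⬝ᵥ g s) (f' ⬝ᵥ g t + f t ⬝ᵥ g') t := by
  have h := HasDerivAt.fun_sum (u := Finset.univ) (A := fun k s => f s k * g s k)
    fun k _ => (hf k).fun_mul (hg k)
  refine h.congr_deriv ?_
  rw [Finset.sum_add_distrib]
  rfl

theorem hasDerivAt_ε {r s : ℝ → ℝ} {r' s' t : ℝ} (hpos : 0 < r t)
    (hr : HasDerivAt r r' t) (hs : HasDerivAt s s' t) :
    HasDerivAt (fun τ => M.ε (r τ, s τ))
      (M.enthalpy (r t) (s t) * r' + M.energyS (r t) (s t) * s') t := by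
  have hε := (differentiableAt_ε (M := M) hpos (s t)).hasFDerivAt
  have h1 : M.enthalpy (r t) (s t) = fderiv ℝ M.ε (r t, s t) (1, 0) :=
    (HasFDerivAt.comp_hasDerivAt (r t) hε
      ((hasDerivAt_id (r t)).prodMk (hasDerivAt_const (r t) (s t)))).deriv
  have h2 : M.energyS (r t) (s t) = fderiv ℝ M.ε (r t, s t) (0, 1) :=
    (HasFDerivAt.comp_hasDerivAt (s t) hε
      ((hasDerivAt_const (s t) (r t)).prodMk (hasDerivAt_id (s t)))).deriv
  refine (HasFDerivAt.comp_hasDerivAt t hε (hr.prodMk hs)).congr_deriv ?_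
  have e : ((r', s') : ℝ × ℝ) = r' • (1, 0) + s' • (0, 1) := by simp
  rw [h1, h2, e, map_add, map_smul, map_smul, smul_eq_mul, smul_eq_mul, mul_comm r', mul_comm s']

/-- The extended operator applied to the Lagrangian density, for a relabelling. -/
theorem lineDeriv_L₀ (hq : q ∈ M.labelDomain)
    (hξ : ∀ j, DifferentiableAt ℝ (fun r => ξ r j) q) :
    lineDeriv ℝ M.L₀ (M.jet q) (M.extended (relabelling ξ) q)
        + M.L₀ (M.jet q) * div ξ q = M.lagrangianLHS ξ q := by
  have hJ := (jac_pos hq).ne'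
  have hρ₀ := (M.ρ₀_pos q.2 hq.2).ne'
  have hμ := M.μ₀_pos.ne'
  set F := M.defMat q with hF
  set K : Matrix (Fin 3) (Fin 3) ℝ := Matrix.of fun s j : Fin 3 => pd j.succ (fun r => ξ r s) q
    with hK
  set v := dt M.X q with hv
  set w := dt ξ q with hw
  -- In Jacobi's formula adj(F)·(-FK) = -JK, and the trace of K is ∇₀·ξ.
  have hdet : HasDerivAt (fun τ : ℝ => (F + τ • (-(F * K))).det) (-(M.jac q * div ξ q)) 0 := by
    have h := hasDerivAt_matrix_det (A := fun τ : ℝ => F + τ • (-(F * K))) (A' := -(F * K)) (t := 0)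
      fun i j => by
        simpa using ((hasDerivAt_id (0 : ℝ)).mul_const ((-(F * K)) i j)).const_add (F i j)
    refine h.congr_deriv ?_
    rw [zero_smul, add_zero, Matrix.mul_neg, ← mul_assoc, Matrix.adjugate_mul, Matrix.smul_mul,
      one_mul, Matrix.trace_neg, Matrix.trace_smul]
    rfl
  have hρ := hasDerivAt_comp_line (differentiableAt_ρ₀ hq) (ξ q)
  have hS := hasDerivAt_comp_line (differentiableAt_S₀ hq) (ξ q)
  have hB : ∀ k, HasDerivAt (fun τ : ℝ => M.B₀ (q.2 + τ • ξ q) k)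
      (advect (ξ q) (fun r => M.B₀ r.2) q k) 0 := fun k =>
    hasDerivAt_comp_line (differentiableAt_B₀ hq k) (ξ q)
  have hvel : ∀ k, HasDerivAt (fun τ : ℝ => (v + τ • (-(F *ᵥ w))) k) ((-(F *ᵥ w)) k) 0 := fun k => by
    simpa using ((hasDerivAt_id (0 : ℝ)).mul_const ((-(F *ᵥ w)) k)).const_add (v k)
  -- The vector F B₀ varies through B₀ by F(ξ·∇₀B₀) and through F by -FK B₀, where K B₀ = B₀·∇₀ξ.
  have hb : ∀ k, HasDerivAt
      (fun τ : ℝ => ((F + τ • (-(F * K))) *ᵥ M.B₀ (q.2 + τ • ξ q)) k)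
      ((F *ᵥ (advect (ξ q) (fun r => M.B₀ r.2) q - advect (M.B₀ q.2) ξ q)) k) 0 := fun k => by
    have hG : ∀ j, HasDerivAt (fun τ : ℝ => (F + τ • (-(F * K))) k j) ((-(F * K)) k j) 0 :=
      fun j => by
        simpa using ((hasDerivAt_id (0 : ℝ)).mul_const ((-(F * K)) k j)).const_add (F k j)
    have h := hasDerivAt_dotProduct (f := fun τ : ℝ => (F + τ • (-(F * K))) k)
      (g := fun τ : ℝ => M.B₀ (q.2 + τ • ξ q)) (f' := (-(F * K)) k) hG hB
    refine h.congr_deriv ?_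
    have hKB : advect (M.B₀ q.2) ξ q = K *ᵥ M.B₀ q.2 := by
      ext s
      simp [advect, hK, Matrix.mulVec, dotProduct, mul_comm]
    rw [hKB, Matrix.mulVec_sub, Matrix.mulVec_mulVec]
    simp only [zero_smul, add_zero, Pi.sub_apply]
    change (-(F * K) *ᵥ M.B₀ q.2) k + (F *ᵥ _) k = _
    rw [Matrix.neg_mulVec, Pi.neg_apply]
    ring
  have hkin := (hρ.fun_mul (hasDerivAt_dotProduct hvel hvel)).div_const 2
  have hFdet : F.det = M.jac q := rfl
  have hdet0 : (F + (0 : ℝ) • (-(F * K))).det ≠ 0 := by simpa [hFdet] using hJ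
  have hr := hρ.fun_div hdet hdet0
  have hpos : 0 < M.ρ₀ (q.2 + (0 : ℝ) • ξ q) / (F + (0 : ℝ) • (-(F * K))).det := by
    simpa [hFdet] using div_pos (M.ρ₀_pos q.2 hq.2) (jac_pos hq)
  have hint := hdet.fun_mul (hasDerivAt_ε (M := M) hpos hr hS)
  have hmag := (hasDerivAt_dotProduct hb hb).fun_div (hdet.const_mul (2 * M.μ₀))
    (mul_ne_zero (mul_ne_zero two_ne_zero hμ) hdet0)
  -- The position component of the extended field is zero, so Φ(x) is constant along the line and is
  -- never differentiated.
  have htot := ((hkin.fun_sub hint).fun_sub hmag).fun_sub (hρ.mul_const (M.Φ (M.X q)))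
  rw [extended_relabelling hq hξ, lineDeriv]
  refine (congrArg (· + M.L₀ (M.jet q) * div ξ q)
    ((congrArg (fun f => deriv f 0) (funext fun τ => ?_)).trans htot.deriv)).trans ?_
  · simp only [L₀, jet, Prod.smul_mk, smul_zero, add_zero]
    rfl
  -- Adding L⁰∇₀·ξ completes ξ·∇₀ρ₀ to ∇₀·(ρ₀ξ) in the kinetic and potential terms. It cancels the
  -- ε∇₀·ξ contribution from varying J, while ρ₀/J varies by ∇₀·(ρ₀ξ)/J, leaving -h∇₀·(ρ₀ξ). It also
  -- doubles the half magnetic term coming from 1/J.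
  rw [lagrangianLHS, vecMulVec_combination, sum_gram_mul_vecMulVec,
    div_smul (differentiableAt_comp_snd (differentiableAt_ρ₀ hq)) hξ, pressure]
  have hdt : dt (fun r => M.ρ₀ r.2 • ξ r) q = M.ρ₀ q.2 • w := by
    ext k
    refine (pd_mul (differentiableAt_comp_snd (differentiableAt_ρ₀ hq)) (hξ k) 0).trans ?_
    rw [pd_zero_comp_snd (differentiableAt_ρ₀ hq), zero_mul, add_zero]
    rfl
  have hgrad : ∑ i, ξ q i * pd i.succ (fun r => M.S₀ r.2) q
      = ξ q ⬝ᵥ grad (fun r => M.S₀ r.2) q := rfl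
  rw [hdt, ← hF, ← hv]
  simp only [L₀, jet, zero_smul, add_zero, ← hF, ← hv, hFdet, hgrad, Matrix.mulVec_smul,
    Matrix.mulVec_add, Matrix.mulVec_sub, smul_dotProduct, neg_dotProduct,
    sub_dotProduct, add_dotProduct, dotProduct_sub, smul_eq_mul, dotProduct_comm v,
    dotProduct_comm (F *ᵥ M.B₀ q.2) (F *ᵥ advect _ _ _)]
  field_simp
  ring

theorem divSymmetryAt_relabelling_iff (hq : q ∈ M.labelDomain)
    (hξ : ∀ j, DifferentiableAt ℝ (fun r => ξ r j) q) (Λ₀ : TimeSpace → Fin 4 → ℝ) :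
    M.DivSymmetryAt (relabelling ξ) Λ₀ q ↔ M.lagrangianLHS ξ q = -div4 Λ₀ q := by
  have hdiv : div4 (relabelling ξ).V4 q = div ξ q := by
    rw [div4_eq]
    exact (congrArg (· + div ξ q) (pd_const 0 0)).trans (zero_add _)
  rw [DivSymmetryAt, hdiv, lineDeriv_L₀ hq hξ, eq_neg_iff_add_eq_zero]

/-! ### Transformation of the gauge four-vector -/

theorem gauge_apply (hq : q ∈ M.labelDomain) (Λ₀ : TimeSpace → Fin 4 → ℝ) (α : Fin 4) :
    M.gauge Λ₀ (M.lagMap q) α = ∑ β, Λ₀ q β * (M.defMat4 q α β / M.jac q) := by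
  simp only [gauge, cofac_invDefMat4 hq, invMap_lagMap hq]

/-- By the cofactor formula the gauge vector coincides near the point with the Piola pushforward of
Λ₀, so their divergences agree there. -/
theorem div4_eq_jac_mul_div4_gauge (hq : q ∈ M.labelDomain) {Λ₀ : TimeSpace → Fin 4 → ℝ}
    (hΛ : ∀ β, DifferentiableAt ℝ (fun r => Λ₀ r β) q) :
    div4 Λ₀ q = M.jac q * div4 (M.gauge Λ₀) (M.lagMap q) := by
  rw [← jac_mul_div4_push hq hΛ]
  obtain ⟨-, -, -, hev⟩ := hasFDerivAt_invMap hq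
  refine congrArg _ (Finset.sum_congr rfl fun α _ => pd_congr ?_ α)
  filter_upwards [hev] with p hp
  have h := gauge_apply hp.1 Λ₀ α
  rw [hp.2] at h
  exact h.symm

theorem gauge_zero (hq : q ∈ M.labelDomain) (Λ₀ : TimeSpace → Fin 4 → ℝ) :
    M.gauge Λ₀ (M.lagMap q) 0 = Λ₀ q 0 / M.jac q := by
  rw [gauge_apply hq, Fin.sum_univ_succ]
  simp only [defMat4_zero_zero, defMat4_zero_succ, zero_div, mul_zero, Finset.sum_const_zero,
    add_zero, mul_one_div]

theorem gauge_succ (hq : q ∈ M.labelDomain) (Λ₀ : TimeSpace → Fin 4 → ℝ) (j : Fin 3) :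
    M.gauge Λ₀ (M.lagMap q) j.succ =
      (M.u (M.lagMap q) j * Λ₀ q 0 + ∑ s : Fin 3, M.defMat q j s * Λ₀ q s.succ) / M.jac q := by
  rw [gauge_apply hq, Fin.sum_univ_succ, u, invMap_lagMap hq, add_div, Finset.sum_div]
  simp only [defMat4_succ_zero, defMat4_succ_succ, mul_div_assoc', mul_comm]

end Flow

end MHD

/-! ### Assembly of the equivalences -/

theorem mainTheorem4 (M : MHD.Flow) (ξ : MHD.TimeSpace → MHD.V3)
    (Λ₀ : MHD.TimeSpace → Fin 4 → ℝ)
    (hξ : ContDiffOn ℝ 1 ξ M.labelDomain) (hΛ₀ : ContDiffOn ℝ 1 Λ₀ M.labelDomain) :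
    -- the divergence symmetry condition of the action is the Lagrangian condition
    (∀ q ∈ M.labelDomain,
      (M.DivSymmetryAt (MHD.relabelling ξ) Λ₀ q ↔
        M.lagrangianLHS ξ q = -MHD.div4 Λ₀ q)) ∧
    -- both sides of the Lagrangian condition are `J` times those of the Eulerian condition
    (∀ q ∈ M.labelDomain,
      M.lagrangianLHS ξ q = M.jac q * M.eulerianLHS ξ (M.lagMap q) ∧
      MHD.div4 Λ₀ q = M.jac q * MHD.div4 (M.gauge Λ₀) (M.lagMap q)) ∧
    -- hence the conditions are equivalent at corresponding points, and on the whole flow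
    (∀ q ∈ M.labelDomain,
      (M.lagrangianLHS ξ q = -MHD.div4 Λ₀ q ↔
        M.eulerianLHS ξ (M.lagMap q) = -MHD.div4 (M.gauge Λ₀) (M.lagMap q))) ∧
    ((∀ q ∈ M.labelDomain, M.DivSymmetryAt (MHD.relabelling ξ) Λ₀ q) ↔
      (∀ p ∈ M.region, M.eulerianLHS ξ p = -MHD.div4 (M.gauge Λ₀) p)) ∧
    -- transformation of the gauge four-vector
    (∀ q ∈ M.labelDomain,
      (∀ α β, MHD.cofac (M.invDefMat4 (M.lagMap q)) β α = M.defMat4 q α β / M.jac q) ∧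
      (∀ α, M.gauge Λ₀ (M.lagMap q) α = ∑ β, Λ₀ q β * (M.defMat4 q α β / M.jac q)) ∧
      M.gauge Λ₀ (M.lagMap q) 0 = Λ₀ q 0 / M.jac q ∧
      (∀ j : Fin 3, M.gauge Λ₀ (M.lagMap q) j.succ =
        (M.u (M.lagMap q) j * Λ₀ q 0 + ∑ s : Fin 3, M.defMat q j s * Λ₀ q s.succ)
          / M.jac q)) := by
  have hξ' : ∀ q ∈ M.labelDomain, ∀ j, DifferentiableAt ℝ (fun r => ξ r j) q := fun q hq =>
    differentiableAt_pi.1 ((hξ.contDiffAt (M.isOpen_labelDomain.mem_nhds hq)).differentiableAt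
      (by norm_num))
  have hΛ' : ∀ q ∈ M.labelDomain, ∀ β, DifferentiableAt ℝ (fun r => Λ₀ r β) q := fun q hq =>
    differentiableAt_pi.1 ((hΛ₀.contDiffAt (M.isOpen_labelDomain.mem_nhds hq)).differentiableAt
      (by norm_num))
  have ha := fun q hq => MHD.Flow.divSymmetryAt_relabelling_iff (M := M) hq (hξ' q hq) Λ₀
  have hb1 := fun q hq => MHD.Flow.lagrangianLHS_eq (M := M) hq (hξ' q hq)
  have hb2 := fun q hq => MHD.Flow.div4_eq_jac_mul_div4_gauge (M := M) hq (hΛ' q hq)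
  have hb : ∀ q ∈ M.labelDomain, (M.lagrangianLHS ξ q = -MHD.div4 Λ₀ q ↔
      M.eulerianLHS ξ (M.lagMap q) = -MHD.div4 (M.gauge Λ₀) (M.lagMap q)) := fun q hq => by
    -- Both sides carry the common factor J, which is cancelled because it is positive.
    rw [hb1 q hq, hb2 q hq, ← mul_neg]
    exact mul_right_inj' (MHD.Flow.jac_pos hq).ne'
  refine ⟨ha, fun q hq => ⟨hb1 q hq, hb2 q hq⟩, hb, ⟨?_, fun h q hq => ?_⟩, fun q hq =>
    ⟨MHD.Flow.cofac_invDefMat4 hq, MHD.Flow.gauge_apply hq Λ₀, MHD.Flow.gauge_zero hq Λ₀,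
      MHD.Flow.gauge_succ hq Λ₀⟩⟩
  -- The occupied region is by definition the image of the label domain, so the pointwise
  -- equivalence covers every Eulerian point.
  · rintro h _ ⟨q, hq, rfl⟩
    exact (hb q hq).1 ((ha q hq).1 (h q hq))
  · exact (ha q hq).2 ((hb q hq).2 (h _ ⟨q, hq, rfl⟩))
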